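/- **Setting.** Let $d,n\ge 1$ be integers, let $\Gamma=(\Gamma_1,\dots,\Gamma_d)$ be a $d$-tuple of digraphs $\Gamma_k\subseteq\langle n\rangle\times\langle n\rangle$ on the set of colors $\langle n\rangle=\{1,\dots,n\}$, and assume that the set $C_\Gamma(\mathbb Z^d)$ of all $\phi:\mathbb Z^d\to\langle n\rangle$ with $(\phi_{i},\phi_{i+e_k})\in\Gamma_k$ for all $i\in\mathbb Z^d$, $k\in\langle d\rangle$ (a nearest neighbor subshift of finite type, NNSOFT) is nonempty. For $m\in\{1,2,\dots\}^d$ let $\langle m\rangle=\langle m_1\rangle\times\dots\times\langle m_d\rangle$, $\mathrm{vol}(m)=m_1\cdots m_d$, and let $C_\Gamma(\langle m\rangle)$ be the set of all $\phi:\langle m\rangle\to\langle n\rangle$ such that $(\phi_i,\phi_{i+e_k})\in\Gamma_k$ whenever $i,i+e_k\in\langle m\rangle$. Let $c(\phi)\in\mathbb Z_{\ge 0}^n$ be the vector of the numbers of sites of each color, and $C_\Gamma(\langle m\rangle,c)=\{\phi\in C_\Gamma(\langle m\rangle): c(\phi)=c\}$. The pressure is $$P_\Gamma(u)=\lim_{m\to\infty}\frac{1}{\mathrm{vol}(m)}\log\sum_{\phi\in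 C_\Gamma(\langle m\rangle)}e^{c(\phi)^{\mathsf T}u},\qquad u\in\mathbb R^n,$$ where $m\to\infty$ means that all $m_k\to\infty$; this limit exists and is finite. Let $\Pi_n\subseteq\mathbb R^n$ be the simplex of probability vectors. A point $p\in\Pi_n$ is a density point if there are $m_q\in\{1,2,\dots\}^d$ and $c_q\in\mathbb Z_{\ge0}^n$ with coordinate sum $\mathrm{vol}(m_q)$, $q\in\mathbb N$, such that $$m_q\to\infty,\qquad C_\Gamma(\langle m_q\rangle,c_q)\ne\emptyset\ \text{ for all } q,\qquad c_q/\mathrm{vol}(m_q)\to p .\tag{1}$$ Let $\Pi_\Gamma$ be the set of density points and, for $p\in\Pi_\Gamma$, let $$h_\Gamma(p)=\sup\ \limsup_{q\to\infty}\frac{\log\#C_\Gamma(\langle m_q\rangle,c_q)}{\mathrm{vol}(m_q)}\ \ge 0,$$ the supremum being over all sequences satisfying (1). Let $P_\Gamma^*(p)=\sup_{u}\,(u^{\mathsf T}p-P_\Gamma(u))\in(-\infty,+\infty]$ be the conjugate, $\operatorname{dom}P_\Gamma^*=\{p:P^*_\Gamma(p)<\infty\}$, $\partial P_\Gamma(u)=\{y: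 P_\Gamma(z)\ge P_\Gamma(u)+y^{\mathsf T}(z-u)\ \forall z\in\mathbb R^n\}$ the subdifferential, $\operatorname{Der}P_\Gamma$ the set of points where $P_\Gamma$ is differentiable, and, for $u\in\mathbb R^n$, $S(u)$ the set of all limits of sequences $\nabla P_\Gamma(u_i)$ with $u_i\in\operatorname{Der}P_\Gamma$, $u_i\to u$. **Theorem 4.4.** (a) $h_\Gamma(p)\le -P_\Gamma^*(p)$ for all $p\in\Pi_\Gamma$. (b) $P_\Gamma(u)=\max_{p\in\Pi_\Gamma}\bigl(p^{\mathsf T}u+h_\Gamma(p)\bigr)$ for all $u\in\mathbb R^n$ (the maximum is attained). For $u\in\mathbb R^n$ put $$\pi(u)=\operatorname*{arg\,max}_{p\in\Pi_\Gamma}\bigl(p^{\mathsf T}u+h_\Gamma(p)\bigr)=\{p\in\Pi_\Gamma: P_\Gamma(u)=p^{\mathsf T}u+h_\Gamma(p)\}.$$ (c) $h_\Gamma(p)=-P_\Gamma^*(p)$ for all $u\in\mathbb R^n$ and $p\in\pi(u)$. (d) $\pi(u)\subseteq\partial P_\Gamma(u)$ for all $u\in\mathbb R^n$. If $u\in\operatorname{Der}P_\Gamma$,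 then $\pi(u)=\{\nabla P_\Gamma(u)\}$. Hence $\bigcup_{u\in\operatorname{Der}P_\Gamma}\partial P_\Gamma(u)\subseteq\Pi_\Gamma$. (e) $S(u)\subseteq\pi(u)$ for all $u\in\mathbb R^n$. (f) $\operatorname{conv}\pi(u)=\operatorname{conv}S(u)=\partial P_\Gamma(u)$ for all $u\in\mathbb R^n$. Hence $\bigcup_{u\in\mathbb R^n}\partial P_\Gamma(u)\subseteq\operatorname{conv}\Pi_\Gamma\subseteq\Pi_n$. (g) $\operatorname{conv}\Pi_\Gamma=\operatorname{dom}P_\Gamma^*$. Moreover, $P_\Gamma$ fails to be differentiable at $u$ if and only if $\pi(u)$ has more than one point. -/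

import Mathlib

open Filter Topology

noncomputable section

namespace NNSOFT

/- ### Convex analysis on `ℝⁿ` -/

/-- The subdifferential `∂f(x)` of a real function on `ℝⁿ`. -/
def subdifferential {n : ℕ} (f : EuclideanSpace ℝ (Fin n) → ℝ) (x : EuclideanSpace ℝ (Fin n)) :
    Set (EuclideanSpace ℝ (Fin n)) :=
  {y | ∀ z, f x + inner ℝ y (z - x) ≤ f z}

/-- The conjugate (Legendre-Fenchel transform) `f*(y) = sup_x (xᵀy - f(x))`, with values in
the extended reals. -/
def conjugate {n : ℕ} (f : EuclideanSpace ℝ (Fin n) → ℝ) (y : EuclideanSpace ℝ (Fin n)) : EReal :=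
  ⨆ x : EuclideanSpace ℝ (Fin n), ((inner ℝ x y - f x : ℝ) : EReal)

/-- The effective domain of an extended-real-valued function. -/
def effDom {n : ℕ} (g : EuclideanSpace ℝ (Fin n) → EReal) : Set (EuclideanSpace ℝ (Fin n)) :=
  {y | g y < ⊤}

/-- `Der f`: the points where `f` is differentiable. -/
def derSet {n : ℕ} (f : EuclideanSpace ℝ (Fin n) → ℝ) : Set (EuclideanSpace ℝ (Fin n)) :=
  {x | DifferentiableAt ℝ f x}

/-- `S(x)`: all limits of sequences `∇f(xᵢ)` with `xᵢ ∈ Der f` and `xᵢ → x`. -/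
def gradientLimits {n : ℕ} (f : EuclideanSpace ℝ (Fin n) → ℝ) (x : EuclideanSpace ℝ (Fin n)) :
    Set (EuclideanSpace ℝ (Fin n)) :=
  {y | ∃ s : ℕ → EuclideanSpace ℝ (Fin n), (∀ i, s i ∈ derSet f) ∧
    Tendsto s atTop (𝓝 x) ∧ Tendsto (fun i => gradient f (s i)) atTop (𝓝 y)}

/-- The simplex `Π_n` of probability vectors. -/
def probSimplex (n : ℕ) : Set (EuclideanSpace ℝ (Fin n)) :=
  {p | (∀ i, 0 ≤ p i) ∧ ∑ i, p i = 1}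

/- ### Colorings

The local restrictions are a tuple `Γ = (Γ₁, …, Γ_d)` of digraphs (loops allowed) on the
colors. -/

/-- `C_Γ(ℤ^d)`: the `Γ`-colorings of the lattice. -/
def latticeColorings {d n : ℕ} (Γ : Fin d → Digraph (Fin n)) : Set ((Fin d → ℤ) → Fin n) :=
  {φ | ∀ (i : Fin d → ℤ) (k : Fin d), (Γ k).Adj (φ i) (φ (i + Pi.single k 1))}

/-- The box `⟨m⟩ = {1, …, m₁} × ⋯ × {1, …, m_d}`. -/
def box {d : ℕ} (m : Fin d → ℕ) : Finset (Fin d → ℕ) := Finset.Icc 1 m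

/-- The volume `m₁ ⋯ m_d`. -/
def vol {d : ℕ} (m : Fin d → ℕ) : ℕ := ∏ k, m k

open Classical in
/-- `C_Γ(⟨m⟩)`: the `Γ`-colorings of the box `⟨m⟩`. -/
def boxColorings {d n : ℕ} (Γ : Fin d → Digraph (Fin n)) (m : Fin d → ℕ) :
    Finset (box m → Fin n) :=
  Finset.univ.filter fun φ => ∀ (i j : box m) (k : Fin d),
    (j : Fin d → ℕ) = (i : Fin d → ℕ) + Pi.single k 1 → (Γ k).Adj (φ i) (φ j)

/-- `c(φ)`: the vector of the numbers of sites of each color. -/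
def colorCount {d n : ℕ} {m : Fin d → ℕ} (φ : box m → Fin n) : Fin n → ℕ :=
  fun i => (Finset.univ.filter fun x => φ x = i).card

/-- `C_Γ(⟨m⟩, c)`: the `Γ`-colorings of `⟨m⟩` with color frequency vector `c`. -/
def boxColoringsWith {d n : ℕ} (Γ : Fin d → Digraph (Fin n)) (m : Fin d → ℕ) (c : Fin n → ℕ) :
    Finset (box m → Fin n) :=
  (boxColorings Γ m).filter fun φ => colorCount φ = c

/-- The grand partition function `Z_Γ(m, u)`. -/
def partitionFunction {d n : ℕ} (Γ : Fin d → Digraph (Fin n)) (m : Fin d → ℕ)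
    (u : EuclideanSpace ℝ (Fin n)) : ℝ :=
  ∑ φ ∈ boxColorings Γ m, Real.exp (∑ i, (colorCount φ i : ℝ) * u i)

/-- The pressure `P_Γ(u) = lim_{m → ∞} log Z_Γ(m, u) / vol(m)`. In the product order, `atTop`
on `Fin d → ℕ` says that every coordinate tends to infinity. -/
def pressure {d n : ℕ} (Γ : Fin d → Digraph (Fin n)) (u : EuclideanSpace ℝ (Fin n)) : ℝ :=
  limUnder atTop fun m : Fin d → ℕ => Real.log (partitionFunction Γ m u) / (vol m : ℝ)

/- ### Density points and the density entropy -/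

/-- The sequences of boxes `m_q` and of color frequency vectors `c_q` that realize the color
density `p`. -/
structure IsDensitySeq {d n : ℕ} (Γ : Fin d → Digraph (Fin n)) (p : EuclideanSpace ℝ (Fin n))
    (m : ℕ → Fin d → ℕ) (c : ℕ → Fin n → ℕ) : Prop where
  pos : ∀ q k, 1 ≤ m q k
  tendsto_box : ∀ k, Tendsto (fun q => m q k) atTop atTop
  sum_eq : ∀ q, ∑ i, c q i = vol (m q)
  nonempty : ∀ q, (boxColoringsWith Γ (m q) (c q)).Nonempty
  tendsto_density : ∀ i, Tendsto (fun q => (c q i : ℝ) / (vol (m q) : ℝ)) atTop (𝓝 (p i))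

/-- `Π_Γ`: the set of density points. -/
def densityPoints {d n : ℕ} (Γ : Fin d → Digraph (Fin n)) : Set (EuclideanSpace ℝ (Fin n)) :=
  {p | p ∈ probSimplex n ∧ ∃ m c, IsDensitySeq Γ p m c}

/-- The density entropy `h_Γ(p)`, taken in the extended reals. -/
def densityEntropy {d n : ℕ} (Γ : Fin d → Digraph (Fin n)) (p : EuclideanSpace ℝ (Fin n)) :
    EReal :=
  ⨆ (m : ℕ → Fin d → ℕ) (c : ℕ → Fin n → ℕ) (_ : IsDensitySeq Γ p m c),
    limsup (fun q => ((Real.log ((boxColoringsWith Γ (m q) (c q)).card : ℝ) / (vol (m q) : ℝ) : ℝ) :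
      EReal)) atTop

/-- The functional `p ↦ pᵀu + h_Γ(p)`. -/
def densityFunctional {d n : ℕ} (Γ : Fin d → Digraph (Fin n)) (u p : EuclideanSpace ℝ (Fin n)) :
    EReal :=
  ((inner ℝ p u : ℝ) : EReal) + densityEntropy Γ p

/-- `π(u)`: the points of `Π_Γ` at which `p ↦ pᵀu + h_Γ(p)` is maximal on `Π_Γ`. -/
def maximizers {d n : ℕ} (Γ : Fin d → Digraph (Fin n)) (u : EuclideanSpace ℝ (Fin n)) :
    Set (EuclideanSpace ℝ (Fin n)) :=
  {p | p ∈ densityPoints Γ ∧ IsMaxOn (densityFunctional Γ u) (densityPoints Γ) p}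

end NNSOFT

end

open NNSOFT

/-!
The partition function of a box is submultiplicative in every side, so Fekete's lemma for boxes
yields the pressure `P`. Everything else rests on two relations between `P` and the density
entropy `h`. A color frequency vector contributes at most the whole partition function, whence
`h p ≤ P u - ⟪p, u⟫` for all `u` (`densityEntropy_le`). Conversely a box `m` admits at most
`(vol m + 1) ^ n` frequency vectors, so one of them carries the partition function up to a
polynomial factor, and by compactness of the simplex these vectors have a limiting density `p` with
equality (`exists_le_densityEntropy`). This is the variational principle, and it makes every
maximizer a subgradient of `P`, of norm at most one.

A diagonal argument shows that the hypograph of `h` is closed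
(`mem_densityPoints_and_le_of_tendsto`). At a point of differentiability the gradient is the only
subgradient, hence the only maximizer, so limits of gradients are maximizers as well. The
subdifferential is the convex hull of the limits of gradients
(`subdifferential_subset_convexHull_gradientLimits`, by Rademacher's theorem and separation), which
squeezes the convex hull of the maximizers between two equal sets. A function with a unique
subgradient at a point is differentiable there, which characterizes non-differentiability.
Finally, the conjugate is at most zero on the hull of the density points, and a hyperplane that
separates a point from this compact hull gives a direction along which the conjugate blows up.
-/

/-! ### Convex hulls of compact sets -/

/-- In finite dimension the convex hull of a compact set is compact: by Carathéodory's theorem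
it is the union, over the finitely many `k ≤ dim E + 1`, of the sets of convex combinations of
`k` points. -/
theorem isCompact_convexHull_of_isCompact {E : Type*} [NormedAddCommGroup E] [NormedSpace ℝ E]
    [FiniteDimensional ℝ E] {s : Set E} (hs : IsCompact s) : IsCompact (convexHull ℝ s) := by
  have key : convexHull ℝ s = ⋃ k ∈ Finset.range (Module.finrank ℝ E + 2),
      (fun p : (Fin k → ℝ) × (Fin k → E) => ∑ i, p.1 i • p.2 i) ''
        (stdSimplex ℝ (Fin k) ×ˢ Set.univ.pi fun _ => s) := by
    apply Set.Subset.antisymm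
    · intro x hx
      obtain ⟨ι, _, z, w, hz, hind, hw, hw1, rfl⟩ := eq_pos_convex_span_of_mem_convexHull hx
      have hcard : Fintype.card ι ≤ Module.finrank ℝ E + 1 :=
        hind.card_le_finrank_succ.trans
          (Nat.add_le_add_right (Submodule.finrank_le _) 1)
      let e := (Fintype.equivFin ι).symm
      refine Set.mem_biUnion (x := Fintype.card ι) (by simpa using by omega) ?_
      refine ⟨(w ∘ e, z ∘ e), ⟨⟨fun i => (hw _).le, ?_⟩, fun i _ => hz ⟨_, rfl⟩⟩, ?_⟩
      · simpa using (e.sum_comp w).trans hw1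
      · exact e.sum_comp fun i => w i • z i
    · refine Set.iUnion₂_subset fun k _ => ?_
      rintro _ ⟨p, ⟨hp1, hp2⟩, rfl⟩
      exact (convex_convexHull ℝ s).sum_mem (fun i _ => hp1.1 i) hp1.2
        fun i _ => subset_convexHull ℝ s (hp2 i trivial)
  rw [key]
  refine Finset.isCompact_biUnion _ fun k _ => ?_
  refine ((isCompact_stdSimplex ℝ (Fin k)).prod (isCompact_univ_pi fun _ => hs)).image ?_
  fun_prop

/-! ### Subdifferentials -/

section Subdifferential

variable {n : ℕ} {f : EuclideanSpace ℝ (Fin n) → ℝ}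

theorem convex_subdifferential (x : EuclideanSpace ℝ (Fin n)) :
    Convex ℝ (subdifferential f x) := by
  intro y hy y' hy' a b ha hb hab z
  have h1 := mul_le_mul_of_nonneg_left (hy z) ha
  have h2 := mul_le_mul_of_nonneg_left (hy' z) hb
  rw [inner_add_left, real_inner_smul_left, real_inner_smul_left]
  obtain rfl : b = 1 - a := by linarith
  linarith

theorem mem_subdifferential_of_tendsto (hf : Continuous f)
    {x y : EuclideanSpace ℝ (Fin n)} {s t : ℕ → EuclideanSpace ℝ (Fin n)}
    (hst : ∀ i, t i ∈ subdifferential f (s i)) (hs : Tendsto s atTop (𝓝 x))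
    (ht : Tendsto t atTop (𝓝 y)) : y ∈ subdifferential f x := by
  intro z
  refine le_of_tendsto_of_tendsto' (((hf.tendsto x).comp hs).add
    (ht.inner (tendsto_const_nhds.sub hs))) (tendsto_const_nhds (x := f z)) fun i => ?_
  exact hst i z

/-- Subgradients are monotone. -/
theorem inner_sub_nonneg_of_mem_subdifferential {x x' y y' : EuclideanSpace ℝ (Fin n)}
    (hy : y ∈ subdifferential f x) (hy' : y' ∈ subdifferential f x') :
    0 ≤ inner ℝ (y' - y) (x' - x) := by
  have h1 := hy x'
  have h2 := hy' x
  rw [← neg_sub x' x, inner_neg_right] at h2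
  rw [inner_sub_left]
  linarith

theorem eq_gradient_of_mem_subdifferential {x y : EuclideanSpace ℝ (Fin n)}
    (hx : DifferentiableAt ℝ f x) (hy : y ∈ subdifferential f x) : y = gradient f x := by
  -- `z ↦ f z - ⟪y, z⟫` is minimal at `x`, hence has vanishing derivative there
  have hmin : IsLocalMin (fun z => f z - inner ℝ y z) x := by
    refine Eventually.of_forall fun z => ?_
    have := hy z
    rw [inner_sub_right] at this
    dsimp only
    linarith
  have hd : HasFDerivAt (fun z => f z - inner ℝ y z) (fderiv ℝ f x - innerSL ℝ y) x :=
    hx.hasFDerivAt.sub (innerSL ℝ y).hasFDerivAt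
  have h0 := hmin.hasFDerivAt_eq_zero hd
  refine ext_inner_right ℝ fun v => ?_
  rw [inner_gradient_left]
  have := congrArg (fun L => L v) h0
  simp only [sub_apply, innerSL_apply_apply, zero_apply]
    at this
  linarith

variable {R : ℝ} (hR : ∀ x, ∃ y ∈ subdifferential f x, ‖y‖ ≤ R)
include hR

theorem lipschitzWith_of_subdifferential : LipschitzWith R.toNNReal f := by
  refine LipschitzWith.of_le_add_mul _ fun x x' => ?_
  obtain ⟨y, hy, hyR⟩ := hR x
  have h1 := hy x'
  have h2 := abs_real_inner_le_norm y (x' - x)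
  have h3 : -(‖y‖ * ‖x' - x‖) ≤ inner ℝ y (x' - x) := neg_le_of_abs_le h2
  have h4 : ‖y‖ * ‖x' - x‖ ≤ R * dist x x' := by
    rw [dist_eq_norm, norm_sub_rev x x']
    gcongr
  rw [Real.coe_toNNReal R ((norm_nonneg _).trans hyR)]
  linarith

theorem gradient_mem_subdifferential {x : EuclideanSpace ℝ (Fin n)}
    (hx : DifferentiableAt ℝ f x) : gradient f x ∈ subdifferential f x ∧ ‖gradient f x‖ ≤ R := by
  obtain ⟨y, hy, hyR⟩ := hR x
  rw [← eq_gradient_of_mem_subdifferential hx hy]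
  exact ⟨hy, hyR⟩

theorem isCompact_gradientLimits (x : EuclideanSpace ℝ (Fin n)) :
    IsCompact (gradientLimits f x) := by
  have hcl : gradientLimits f x = (fun y => (x, y)) ⁻¹'
      closure ((fun s => (s, gradient f s)) '' derSet f) := by
    ext y
    rw [Set.mem_preimage, mem_closure_iff_seq_limit]
    constructor
    · rintro ⟨s, hs, hsx, hsy⟩
      exact ⟨fun i => (s i, gradient f (s i)), fun i => ⟨s i, hs i, rfl⟩, hsx.prodMk_nhds hsy⟩
    · rintro ⟨p, hp, hlim⟩
      choose s hs hsp using hp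
      obtain ⟨h1, h2⟩ := Prod.tendsto_iff _ _ |>.1 hlim
      refine ⟨s, hs, ?_, ?_⟩
      · simpa [← hsp] using h1
      · simpa [← hsp] using h2
  refine (isCompact_closedBall (0 : EuclideanSpace ℝ (Fin n)) R).of_isClosed_subset ?_ ?_
  · rw [hcl]
    exact isClosed_closure.preimage (by fun_prop)
  · rintro y ⟨s, hs, -, hsy⟩
    refine Metric.isClosed_closedBall.mem_of_tendsto hsy (Eventually.of_forall fun i => ?_)
    simpa using (gradient_mem_subdifferential hR (hs i)).2

/-- Every subgradient at `x` is a convex combination of limits of gradients at nearby points of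
differentiability. Otherwise a direction `v` separates a subgradient `y` strictly from these limits;
gradients at points of differentiability (dense, by Rademacher's theorem) that approach `x` along
`v` accumulate at some `g`, and monotonicity of the subdifferential forces `⟪g - y, v⟫ ≥ 0`. -/
theorem subdifferential_subset_convexHull_gradientLimits (x : EuclideanSpace ℝ (Fin n)) :
    subdifferential f x ⊆ convexHull ℝ (gradientLimits f x) := by
  intro y hy
  by_contra hny
  obtain ⟨φ, a, hφ, hya⟩ := geometric_hahn_banach_closed_point (convex_convexHull ℝ _)
    (isCompact_convexHull_of_isCompact (isCompact_gradientLimits hR x)).isClosed hny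
  set v := (InnerProductSpace.toDual ℝ (EuclideanSpace ℝ (Fin n))).symm φ with hv
  have hφv : ∀ z, φ z = inner ℝ z v := fun z => by
    rw [real_inner_comm, hv, InnerProductSpace.toDual_symm_apply]
  have hdense : Dense (derSet f) := MeasureTheory.Measure.dense_of_ae (μ := MeasureTheory.volume)
    (lipschitzWith_of_subdifferential hR).ae_differentiableAt
  -- `w i` is a displacement, rescaled, and converges to `v`
  have hex : ∀ i : ℕ, ∃ w, dist w v < 1 / ((i : ℝ) + 1) ∧
      x + (1 / ((i : ℝ) + 1)) • w ∈ derSet f := by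
    intro i
    have hpos : (0 : ℝ) < 1 / ((i : ℝ) + 1) := by positivity
    obtain ⟨s, hs, hsd⟩ := hdense.exists_dist_lt (x + (1 / ((i : ℝ) + 1)) • v)
      (mul_pos hpos hpos)
    refine ⟨((i : ℝ) + 1) • (s - x), ?_, ?_⟩
    · have h1 : ((i : ℝ) + 1) • (s - x) - v
          = ((i : ℝ) + 1) • (s - (x + (1 / ((i : ℝ) + 1)) • v)) := by
        rw [smul_sub, smul_sub, smul_add, smul_smul, mul_one_div_cancel (by positivity), one_smul]
        abel
      rw [dist_eq_norm, h1, norm_smul, Real.norm_of_nonneg (by positivity), ← dist_eq_norm,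
        dist_comm]
      calc ((i : ℝ) + 1) * _ < ((i : ℝ) + 1) * (1 / ((i : ℝ) + 1) * (1 / ((i : ℝ) + 1))) := by
            gcongr
        _ = _ := by field_simp
    · rw [smul_smul, one_div_mul_cancel (by positivity), one_smul, add_sub_cancel]
      exact hs
  choose w hwv hwd using hex
  have hwlim : Tendsto w atTop (𝓝 v) := tendsto_iff_dist_tendsto_zero.2 <|
    squeeze_zero (fun _ => dist_nonneg) (fun i => (hwv i).le) tendsto_one_div_add_atTop_nhds_zero_nat
  set s : ℕ → EuclideanSpace ℝ (Fin n) := fun i => x + (1 / ((i : ℝ) + 1)) • w i with hs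
  have hslim : Tendsto s atTop (𝓝 x) := by
    simpa [hs] using (tendsto_const_nhds (x := x)).add
      ((tendsto_one_div_add_atTop_nhds_zero_nat (𝕜 := ℝ)).smul hwlim)
  obtain ⟨g, -, ψ, hψ, hg⟩ := (isCompact_closedBall (0 : EuclideanSpace ℝ (Fin n)) R).tendsto_subseq
    (x := fun i => gradient f (s i))
    fun i => mem_closedBall_zero_iff.2 (gradient_mem_subdifferential hR (hwd i)).2
  have hgS : g ∈ gradientLimits f x :=
    ⟨s ∘ ψ, fun i => hwd _, hslim.comp hψ.tendsto_atTop, hg⟩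
  have hnn : 0 ≤ inner ℝ (g - y) v := by
    refine ge_of_tendsto' ((hg.sub_const y).inner (hwlim.comp hψ.tendsto_atTop)) fun i => ?_
    have h1 := inner_sub_nonneg_of_mem_subdifferential hy
      (gradient_mem_subdifferential hR (hwd (ψ i))).1
    rw [add_sub_cancel_left, real_inner_smul_right] at h1
    exact nonneg_of_mul_nonneg_right h1 (by positivity)
  have h1 := hφ g (subset_convexHull ℝ _ hgS)
  rw [hφv] at h1 hya
  rw [inner_sub_left] at hnn
  linarith

/-- A function with a unique subgradient at `x` is differentiable there, because the
subdifferential is outer semicontinuous. -/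
theorem differentiableAt_of_subdifferential_subset_singleton {x p : EuclideanSpace ℝ (Fin n)}
    (hp : subdifferential f x ⊆ {p}) : DifferentiableAt ℝ f x := by
  have hcont := (lipschitzWith_of_subdifferential hR).continuous
  choose g hg hgR using hR
  have hgx : g x = p := hp (hg x)
  have hglim : Tendsto g (𝓝 x) (𝓝 p) := by
    rw [tendsto_iff_seq_tendsto]
    intro s hs
    refine tendsto_of_subseq_tendsto fun ns hns => ?_
    obtain ⟨q, -, ψ, hψ, hq⟩ := (isCompact_closedBall
      (0 : EuclideanSpace ℝ (Fin n)) R).tendsto_subseq (x := fun i => g (s (ns i)))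
      fun i => by simpa using hgR _
    obtain rfl : q = p := hp <| mem_subdifferential_of_tendsto hcont (fun i => hg (s (ns (ψ i))))
      (hs.comp (hns.comp hψ.tendsto_atTop)) hq
    exact ⟨ψ, hq⟩
  have hgrad : HasGradientAt f p x := by
    rw [hasGradientAt_iff_hasFDerivAt, hasFDerivAt_iff_isLittleO, Asymptotics.isLittleO_iff]
    intro c hc
    filter_upwards [Metric.tendsto_nhds.1 hglim c hc] with z hz
    have h1 := hg x z
    have h2 := hg z x
    have h3 : inner ℝ (g z - p) (z - x) ≤ c * ‖z - x‖ :=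
      (real_inner_le_norm _ _).trans (by rw [← dist_eq_norm]; gcongr)
    rw [← neg_sub z x, inner_neg_right] at h2
    rw [hgx] at h1
    rw [inner_sub_left] at h3
    rw [InnerProductSpace.toDual_apply_apply, Real.norm_of_nonneg (by linarith)]
    linarith
  exact hgrad.differentiableAt

end Subdifferential

/-! ### Multidimensional Fekete lemma -/

section Fekete

variable {ι : Type*} [DecidableEq ι]

theorem prod_update_cast [Fintype ι] (m : ι → ℕ) (k : ι) (a : ℕ) :
    ∏ j, (Function.update m k a j : ℝ) = a * ∏ j ∈ Finset.univ.erase k, (m j : ℝ) := by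
  rw [← Finset.mul_prod_erase _ _ (Finset.mem_univ k), Function.update_self]
  congr 1
  refine Finset.prod_congr rfl fun j hj => ?_
  rw [Function.update_of_ne (Finset.ne_of_mem_erase hj)]

variable {f : (ι → ℕ) → ℝ} (hsub : ∀ m k a b, f (Function.update m k (a + b)) ≤
  f (Function.update m k a) + f (Function.update m k b))
include hsub

theorem update_mul_add_le_of_subadditive (m : ι → ℕ) (k : ι) (M r q : ℕ) :
    f (Function.update m k (M * q + r)) ≤
      q * f (Function.update m k M) + f (Function.update m k r) := by
  induction q with
  | zero => simp
  | succ q ih =>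
    have := hsub m k M (M * q + r)
    rw [show M * (q + 1) + r = M + (M * q + r) by ring]
    push_cast
    linarith

variable [Fintype ι] {C : ℝ} (h0 : ∀ m, 0 ≤ f m) (hC : ∀ m, f m ≤ C * ∏ k, (m k : ℝ))
include h0 hC

/-- Shrinking the side `m k` to `M` raises the mean of a subadditive function, up to the share
of a remainder of length less than `M`. -/
theorem div_prod_le_update_of_subadditive (m : ι → ℕ) (hm : ∀ j, 1 ≤ m j) (k : ι) {M : ℕ}
    (hM : 1 ≤ M) :
    f m / ∏ j, (m j : ℝ) ≤ f (Function.update m k M) / ∏ j, (Function.update m k M j : ℝ)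
      + C * (M / m k) := by
  have hMpos : (0 : ℝ) < M := by exact_mod_cast hM
  have hmpos : (0 : ℝ) < m k := by exact_mod_cast hm k
  set V := ∏ j ∈ Finset.univ.erase k, (m j : ℝ) with hV
  have hVpos : 0 < V := Finset.prod_pos fun j _ => by exact_mod_cast hm j
  have hprod : ∏ j, (m j : ℝ) = m k * V := (Finset.mul_prod_erase _ _ (Finset.mem_univ k)).symm
  have hCnn : 0 ≤ C := by
    have h := (h0 m).trans (hC m)
    rw [hprod] at h
    exact nonneg_of_mul_nonneg_left h (by positivity)
  have h1 := update_mul_add_le_of_subadditive hsub m k M (m k % M) (m k / M)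
  rw [Nat.div_add_mod, Function.update_eq_self] at h1
  have h2 := hC (Function.update m k (m k % M))
  rw [prod_update_cast] at h2
  have h3 : ((m k % M : ℕ) : ℝ) ≤ M := by exact_mod_cast (Nat.mod_lt _ hM).le
  have h4 : ((m k / M : ℕ) : ℝ) * M ≤ m k := by exact_mod_cast Nat.div_mul_le_self _ _
  have h5 : f m ≤ m k / M * f (Function.update m k M) + C * (M * V) := by
    have h6 : ((m k / M : ℕ) : ℝ) ≤ m k / M := by rwa [le_div_iff₀ hMpos]
    have h7 := mul_le_mul_of_nonneg_right h6 (h0 (Function.update m k M))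
    have h8 : C * (((m k % M : ℕ) : ℝ) * V) ≤ C * (M * V) := by gcongr
    linarith
  rw [prod_update_cast, hprod, ← hV, div_le_iff₀ (by positivity)]
  refine h5.trans (le_of_eq ?_)
  field_simp

/-- **Fekete's lemma** for functions of boxes: a nonnegative function of the side lengths that is
subadditive in every side and bounded by a multiple of the volume has a limiting mean. -/
theorem exists_tendsto_div_prod_of_subadditive :
    ∃ L, Tendsto (fun m : ι → ℕ => f m / ∏ k, (m k : ℝ)) atTop (𝓝 L) := by
  have key : ∀ M : ι → ℕ, (∀ j, 1 ≤ M j) → ∀ m : ι → ℕ, (∀ j, 1 ≤ m j) → ∀ s : Finset ι,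
      f m / ∏ j, (m j : ℝ) ≤ f (s.piecewise M m) / ∏ j, (s.piecewise M m j : ℝ)
        + C * ∑ k ∈ s, (M k : ℝ) / m k := by
    intro M hM m hm s
    induction s using Finset.induction_on with
    | empty => simp
    | insert k s hk ih =>
      have h1 := div_prod_le_update_of_subadditive hsub h0 hC (s.piecewise M m)
        (fun j => by by_cases h : j ∈ s <;> simp [h, hM, hm]) k (hM k)
      rw [← Finset.piecewise_insert, Finset.piecewise_eq_of_notMem _ _ _ hk] at h1
      rw [Finset.sum_insert hk, mul_add]
      linarith
  set S := (fun m : ι → ℕ => f m / ∏ k, (m k : ℝ)) '' {m | ∀ j, 1 ≤ m j} with hS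
  have hbdd : BddBelow S := ⟨0, by
    rintro _ ⟨m, -, rfl⟩
    exact div_nonneg (h0 m) (by positivity)⟩
  have hne : S.Nonempty := ⟨_, fun _ => 1, fun _ => le_rfl, rfl⟩
  have hpos : ∀ᶠ m : ι → ℕ in atTop, ∀ j, 1 ≤ m j := eventually_ge_atTop fun _ => 1
  refine ⟨sInf S, tendsto_order.2 ⟨fun a ha => ?_, fun a ha => ?_⟩⟩
  · filter_upwards [hpos] with m hm
    exact ha.trans_le (csInf_le hbdd ⟨m, hm, rfl⟩)
  · obtain ⟨_, ⟨M, hM, rfl⟩, hMa⟩ := exists_lt_of_csInf_lt hne ha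
    have hlim : Tendsto (fun m : ι → ℕ => f M / ∏ j, (M j : ℝ) + C * ∑ k, (M k : ℝ) / m k)
        atTop (𝓝 (f M / ∏ j, (M j : ℝ) + C * ∑ _k : ι, (0 : ℝ))) := by
      refine tendsto_const_nhds.add (Tendsto.const_mul _ (tendsto_finsetSum _ fun k _ => ?_))
      refine Tendsto.div_atTop tendsto_const_nhds (tendsto_natCast_atTop_atTop.comp ?_)
      exact tendsto_atTop_atTop.2 fun b => ⟨fun _ => b, fun m hm => hm k⟩
    rw [Finset.sum_const_zero, mul_zero, add_zero] at hlim
    filter_upwards [hpos, (tendsto_order.1 hlim).2 a hMa] with m hm hma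
    have := key M hM m hm Finset.univ
    rw [Finset.piecewise_univ] at this
    exact this.trans_lt hma

end Fekete

namespace NNSOFT

/-! ### Colorings of boxes -/

section Boxes

variable {d n : ℕ} {Γ : Fin d → Digraph (Fin n)}

theorem mem_box {m x : Fin d → ℕ} : x ∈ box m ↔ ∀ k, 1 ≤ x k ∧ x k ≤ m k := by
  simp [box, Pi.le_def, forall_and]

theorem card_box (m : Fin d → ℕ) : (box m).card = vol m := by
  simp [box, vol, Pi.card_Icc]

theorem cast_vol (m : Fin d → ℕ) : (vol m : ℝ) = ∏ k, (m k : ℝ) := by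
  simp [vol]

theorem sum_colorCount {m : Fin d → ℕ} (φ : box m → Fin n) : ∑ i, colorCount φ i = vol m := by
  rw [← card_box, ← Fintype.card_coe, ← Finset.card_univ]
  exact (Finset.card_eq_sum_card_fiberwise fun _ _ => Finset.mem_coe.2 (Finset.mem_univ _)).symm

theorem sum_colorCount_mul {m : Fin d → ℕ} (φ : box m → Fin n) (u : Fin n → ℝ) :
    ∑ i, (colorCount φ i : ℝ) * u i = ∑ x, u (φ x) := by
  rw [← Finset.sum_fiberwise Finset.univ φ fun x => u (φ x)]
  refine Finset.sum_congr rfl fun i _ => ?_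
  rw [Finset.sum_congr rfl (g := fun _ => u i) fun x hx => by rw [(Finset.mem_filter.1 hx).2]]
  simp [colorCount]

theorem mem_boxColorings {m : Fin d → ℕ} {φ : box m → Fin n} :
    φ ∈ boxColorings Γ m ↔ ∀ (i j : box m) (k : Fin d),
      (j : Fin d → ℕ) = (i : Fin d → ℕ) + Pi.single k 1 → (Γ k).Adj (φ i) (φ j) := by
  simp [boxColorings]

/-- Box colorings pull back along translations of boxes. -/
theorem comp_mem_boxColorings {m m' : Fin d → ℕ} {φ : box m → Fin n} (hφ : φ ∈ boxColorings Γ m)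
    (e : box m' → box m) (t : Fin d → ℕ) (he : ∀ x, (e x : Fin d → ℕ) = x + t) :
    φ ∘ e ∈ boxColorings Γ m' := by
  rw [mem_boxColorings] at hφ ⊢
  intro i j k hij
  refine hφ _ _ k ?_
  rw [he, he, hij]
  abel

theorem boxColorings_nonempty (hΓ : (latticeColorings Γ).Nonempty) (m : Fin d → ℕ) :
    (boxColorings Γ m).Nonempty := by
  obtain ⟨φ, hφ⟩ := hΓ
  refine ⟨fun x => φ fun k => ((x : Fin d → ℕ) k : ℤ), mem_boxColorings.2 fun i j k hij => ?_⟩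
  have h : (fun l => ((j : Fin d → ℕ) l : ℤ)) = (fun l => ((i : Fin d → ℕ) l : ℤ)) +
      Pi.single k 1 := by
    ext l
    rw [hij]
    by_cases h : l = k
    · subst h; simp
    · simp [h]
  rw [h]
  exact hφ _ k

theorem partitionFunction_eq (m : Fin d → ℕ) (u : EuclideanSpace ℝ (Fin n)) :
    partitionFunction Γ m u = ∑ φ ∈ boxColorings Γ m, Real.exp (∑ x, u (φ x)) :=
  Finset.sum_congr rfl fun φ _ => by rw [sum_colorCount_mul]

theorem partitionFunction_pos (hΓ : (latticeColorings Γ).Nonempty) (m : Fin d → ℕ)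
    (u : EuclideanSpace ℝ (Fin n)) : 0 < partitionFunction Γ m u :=
  Finset.sum_pos (fun _ _ => Real.exp_pos _) (boxColorings_nonempty hΓ m)

/-- The partition function is submultiplicative in every side of the box: cutting the box into two
slabs maps its colorings injectively to pairs of colorings of the slabs. -/
theorem partitionFunction_update_add_le (u : EuclideanSpace ℝ (Fin n)) (m : Fin d → ℕ) (k : Fin d)
    (a b : ℕ) :
    partitionFunction Γ (Function.update m k (a + b)) u ≤
      partitionFunction Γ (Function.update m k a) u *
        partitionFunction Γ (Function.update m k b) u := by
  have hup : ∀ (c : ℕ) (x : Fin d → ℕ), x ∈ box (Function.update m k c) ↔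
      (∀ l, l ≠ k → 1 ≤ x l ∧ x l ≤ m l) ∧ 1 ≤ x k ∧ x k ≤ c := by
    intro c x
    rw [mem_box]
    constructor
    · exact fun h => ⟨fun l hl => by simpa [hl] using h l, by simpa using h k⟩
    · rintro ⟨h1, h2⟩ l
      by_cases hl : l = k
      · subst hl; simpa using h2
      · simpa [hl] using h1 l hl
  let e₁ : box (Function.update m k a) → box (Function.update m k (a + b)) := fun x =>
    ⟨x, by
      have := (hup _ _).1 x.2
      exact (hup _ _).2 ⟨this.1, this.2.1, by omega⟩⟩
  let e₂ : box (Function.update m k b) → box (Function.update m k (a + b)) := fun x =>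
    ⟨(x : Fin d → ℕ) + Pi.single k a, by
      have := (hup _ _).1 x.2
      refine (hup _ _).2 ⟨fun l hl => by simpa [hl] using this.1 l hl, ?_⟩
      simp only [Pi.add_apply, Pi.single_eq_same]
      omega⟩
  have he : Function.Bijective (Sum.elim e₁ e₂) := by
    constructor
    · refine Function.Injective.sumElim ?_ ?_ ?_
      · intro x y hxy
        have h := Subtype.ext_iff.1 hxy
        exact Subtype.ext h
      · intro x y hxy
        have h := Subtype.ext_iff.1 hxy
        exact Subtype.ext (add_right_cancel h)
      · intro x y hxy
        have h1 := congrFun (congrArg Subtype.val hxy) k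
        have h2 := (hup _ _).1 x.2
        have h3 := (hup _ _).1 y.2
        simp only [e₁, e₂, Pi.add_apply, Pi.single_eq_same] at h1
        omega
    · intro y
      have hy := (hup _ _).1 y.2
      by_cases h : (y : Fin d → ℕ) k ≤ a
      · exact ⟨Sum.inl ⟨y, (hup _ _).2 ⟨hy.1, hy.2.1, h⟩⟩, rfl⟩
      · refine ⟨Sum.inr ⟨(y : Fin d → ℕ) - Pi.single k a, (hup _ _).2 ⟨fun l hl => ?_, ?_⟩⟩, ?_⟩
        · simpa [hl] using hy.1 l hl
        · simp only [Pi.sub_apply, Pi.single_eq_same]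
          omega
        · refine Subtype.ext (funext fun l => ?_)
          by_cases hl : l = k
          · subst hl
            simp only [Sum.elim_inr, e₂, Pi.add_apply, Pi.sub_apply, Pi.single_eq_same]
            omega
          · simp [e₂, hl]
  have hw : ∀ φ : box (Function.update m k (a + b)) → Fin n, Real.exp (∑ x, u (φ x)) =
      Real.exp (∑ x, u ((φ ∘ e₁) x)) * Real.exp (∑ x, u ((φ ∘ e₂) x)) := by
    intro φ
    rw [← Real.exp_add, ← he.sum_comp fun x => u (φ x), Fintype.sum_sum_type]
    rfl
  simp only [partitionFunction_eq]
  rw [Finset.sum_mul_sum, ← Finset.sum_product']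
  simp only [hw]
  have hinj : Function.Injective fun φ : box (Function.update m k (a + b)) → Fin n =>
      (φ ∘ e₁, φ ∘ e₂) := by
    intro φ ψ h
    obtain ⟨h1, h2⟩ := Prod.mk.inj h
    funext y
    obtain ⟨x | x, rfl⟩ := he.2 y
    · exact congrFun h1 x
    · exact congrFun h2 x
  rw [← Finset.sum_image (f := fun p : (box (Function.update m k a) → Fin n) ×
    (box (Function.update m k b) → Fin n) => Real.exp (∑ x, u (p.1 x)) *
      Real.exp (∑ x, u (p.2 x))) hinj.injOn]
  refine Finset.sum_le_sum_of_subset_of_nonneg ?_ fun _ _ _ => by positivity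
  intro p hp
  obtain ⟨φ, hφ, rfl⟩ := Finset.mem_image.1 hp
  exact Finset.mem_product.2 ⟨comp_mem_boxColorings hφ e₁ 0 fun x => (add_zero _).symm,
    comp_mem_boxColorings hφ e₂ (Pi.single k a) fun x => rfl⟩

theorem abs_sum_le_vol_mul {m : Fin d → ℕ} (u : EuclideanSpace ℝ (Fin n)) (φ : box m → Fin n) :
    |∑ x, u (φ x)| ≤ vol m * ∑ i, |u i| := by
  refine (Finset.abs_sum_le_sum_abs _ _).trans ?_
  rw [← card_box, ← Fintype.card_coe, ← Finset.card_univ, ← nsmul_eq_mul]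
  exact Finset.sum_le_card_nsmul _ _ _ fun x _ =>
    Finset.single_le_sum (f := fun i => |u i|) (fun _ _ => abs_nonneg _) (Finset.mem_univ (φ x))

theorem neg_vol_mul_le_log_partitionFunction (hΓ : (latticeColorings Γ).Nonempty) (m : Fin d → ℕ)
    (u : EuclideanSpace ℝ (Fin n)) :
    -(vol m * ∑ i, |u i|) ≤ Real.log (partitionFunction Γ m u) := by
  obtain ⟨φ, hφ⟩ := boxColorings_nonempty hΓ m
  rw [Real.le_log_iff_exp_le (partitionFunction_pos hΓ m u), partitionFunction_eq]
  refine le_trans ?_ (Finset.single_le_sum (f := fun φ : box m → Fin n =>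
    Real.exp (∑ x, u (φ x))) (fun _ _ => (Real.exp_pos _).le) hφ)
  exact Real.exp_le_exp.2 (neg_le_of_abs_le (abs_sum_le_vol_mul u φ))

theorem log_partitionFunction_le (hΓ : (latticeColorings Γ).Nonempty) (m : Fin d → ℕ)
    (u : EuclideanSpace ℝ (Fin n)) :
    Real.log (partitionFunction Γ m u) ≤ vol m * (Real.log n + ∑ i, |u i|) := by
  have hn : (0 : ℝ) < n := by
    obtain ⟨φ, -⟩ := hΓ
    exact_mod_cast Fin.pos (φ 0)
  rw [Real.log_le_iff_le_exp (partitionFunction_pos hΓ m u), partitionFunction_eq]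
  calc _ ≤ ((boxColorings Γ m).card : ℝ) * Real.exp (vol m * ∑ i, |u i|) := by
        rw [← nsmul_eq_mul]
        exact Finset.sum_le_card_nsmul _ _ _ fun φ _ =>
          Real.exp_le_exp.2 (le_of_abs_le (abs_sum_le_vol_mul u φ))
    _ ≤ (n : ℝ) ^ vol m * Real.exp (vol m * ∑ i, |u i|) := by
        gcongr
        have := (boxColorings Γ m).card_le_univ
        rw [Fintype.card_fun, Fintype.card_fin, Fintype.card_coe, card_box] at this
        exact_mod_cast this
    _ = _ := by
        rw [mul_add, Real.exp_add, mul_comm (vol m : ℝ) (Real.log n), Real.exp_mul (Real.log n),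
          Real.exp_log hn, Real.rpow_natCast]

theorem tendsto_pressure (hΓ : (latticeColorings Γ).Nonempty) (u : EuclideanSpace ℝ (Fin n)) :
    Tendsto (fun m : Fin d → ℕ => Real.log (partitionFunction Γ m u) / (vol m : ℝ))
      atTop (𝓝 (pressure Γ u)) := by
  refine tendsto_nhds_limUnder ?_
  set B := ∑ i, |u i|
  -- adding a multiple of the volume makes the logarithm nonnegative and keeps subadditivity
  obtain ⟨L, hL⟩ := exists_tendsto_div_prod_of_subadditive
    (f := fun m : Fin d → ℕ => Real.log (partitionFunction Γ m u) + B * ∏ k, (m k : ℝ))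
    (C := Real.log n + B + B) (fun m k a b => by
      have h := Real.log_le_log (partitionFunction_pos hΓ _ u)
        (partitionFunction_update_add_le u m k a b)
      rw [Real.log_mul (partitionFunction_pos hΓ _ u).ne' (partitionFunction_pos hΓ _ u).ne'] at h
      simp only [prod_update_cast]
      push_cast
      linarith)
    (fun m => by
      have := neg_vol_mul_le_log_partitionFunction hΓ m u
      rw [cast_vol] at this
      linarith)
    (fun m => by
      have := log_partitionFunction_le hΓ m u
      rw [cast_vol] at this
      linarith)
  refine ⟨L - B, (hL.sub_const B).congr' ?_⟩
  filter_upwards [eventually_ge_atTop fun _ => 1] with m hm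
  have : (0 : ℝ) < ∏ k, (m k : ℝ) := Finset.prod_pos fun k _ => by exact_mod_cast hm k
  rw [cast_vol]
  field_simp
  ring

end Boxes

/-! ### Density points and the density entropy -/

section Density

variable {d n : ℕ} {Γ : Fin d → Digraph (Fin n)}

theorem inner_eq_sum (p u : EuclideanSpace ℝ (Fin n)) : inner ℝ p u = ∑ i, p i * u i := by
  simp [PiLp.inner_apply, mul_comm]

theorem convex_probSimplex (n : ℕ) : Convex ℝ (probSimplex n) := by
  intro x hx y hy a b ha hb hab
  refine ⟨fun i => ?_, ?_⟩
  · have := mul_nonneg ha (hx.1 i)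
    have := mul_nonneg hb (hy.1 i)
    simp only [PiLp.add_apply, PiLp.smul_apply, smul_eq_mul]
    linarith
  · simp only [PiLp.add_apply, PiLp.smul_apply, smul_eq_mul, Finset.sum_add_distrib,
      ← Finset.mul_sum, hx.2, hy.2]
    linarith

theorem norm_le_one_of_mem_probSimplex {p : EuclideanSpace ℝ (Fin n)} (hp : p ∈ probSimplex n) :
    ‖p‖ ≤ 1 := by
  have hle : ∀ i, p i ≤ 1 := fun i =>
    hp.2 ▸ Finset.single_le_sum (f := fun i => p i) (fun i _ => hp.1 i) (Finset.mem_univ i)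
  have h : ‖p‖ ^ 2 ≤ 1 := by
    rw [EuclideanSpace.real_norm_sq_eq, ← hp.2]
    exact Finset.sum_le_sum fun i _ => by nlinarith [hp.1 i, hle i]
  nlinarith [norm_nonneg p]

theorem isClosed_probSimplex (n : ℕ) : IsClosed (probSimplex n) := by
  refine IsClosed.inter (s₁ := {p : EuclideanSpace ℝ (Fin n) | ∀ i, 0 ≤ p i})
    (s₂ := {p : EuclideanSpace ℝ (Fin n) | ∑ i, p i = 1}) ?_ ?_
  · rw [Set.ofPred_forall]
    exact isClosed_iInter fun i => isClosed_le continuous_const (by fun_prop)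
  · exact isClosed_eq (by fun_prop) continuous_const

theorem isCompact_probSimplex (n : ℕ) : IsCompact (probSimplex n) :=
  (isCompact_closedBall (0 : EuclideanSpace ℝ (Fin n)) 1).of_isClosed_subset
    (isClosed_probSimplex n)
    fun _ hp => mem_closedBall_zero_iff.2 (norm_le_one_of_mem_probSimplex hp)

theorem vol_pos {m : Fin d → ℕ} (hm : ∀ k, 1 ≤ m k) : 0 < vol m :=
  Finset.prod_pos fun k _ => hm k

theorem sum_eq_vol_of_nonempty {m : Fin d → ℕ} {c : Fin n → ℕ}
    (h : (boxColoringsWith Γ m c).Nonempty) : ∑ i, c i = vol m := by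
  obtain ⟨φ, hφ⟩ := h
  rw [← (Finset.mem_filter.1 hφ).2, sum_colorCount]

/-- The color densities `c / vol m`. -/
noncomputable def density (m : Fin d → ℕ) (c : Fin n → ℕ) : EuclideanSpace ℝ (Fin n) :=
  WithLp.toLp 2 fun i => (c i : ℝ) / (vol m : ℝ)

theorem density_mem_probSimplex {m : Fin d → ℕ} {c : Fin n → ℕ} (hm : ∀ k, 1 ≤ m k)
    (hc : ∑ i, c i = vol m) : density m c ∈ probSimplex n := by
  have : (vol m : ℝ) ≠ 0 := by exact_mod_cast (vol_pos hm).ne'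
  refine ⟨fun i => by simp only [density]; positivity, ?_⟩
  simp only [density]
  rw [← Finset.sum_div, ← Nat.cast_sum, hc, div_self this]

theorem tendsto_density_iff {p : EuclideanSpace ℝ (Fin n)} {m : ℕ → Fin d → ℕ}
    {c : ℕ → Fin n → ℕ} : Tendsto (fun q => density (m q) (c q)) atTop (𝓝 p) ↔
      ∀ i, Tendsto (fun q => (c q i : ℝ) / (vol (m q) : ℝ)) atTop (𝓝 (p i)) := by
  rw [(PiLp.homeomorph 2 fun _ : Fin n => ℝ).isInducing.tendsto_nhds_iff, tendsto_pi_nhds]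
  rfl

variable {p : EuclideanSpace ℝ (Fin n)} {m : ℕ → Fin d → ℕ} {c : ℕ → Fin n → ℕ}

theorem IsDensitySeq.mem_densityPoints (h : IsDensitySeq Γ p m c) : p ∈ densityPoints Γ :=
  ⟨(isClosed_probSimplex n).mem_of_tendsto (tendsto_density_iff.2 h.tendsto_density)
    (Eventually.of_forall fun q => density_mem_probSimplex (h.pos q) (h.sum_eq q)), m, c, h⟩

theorem IsDensitySeq.tendsto_box_atTop (h : IsDensitySeq Γ p m c) : Tendsto m atTop atTop :=
  tendsto_atTop.2 fun b => eventually_all.2 fun k => (h.tendsto_box k).eventually_ge_atTop (b k)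

theorem IsDensitySeq.le_densityEntropy (h : IsDensitySeq Γ p m c) {b : ℕ → ℝ} {a : ℝ}
    (hb : Tendsto b atTop (𝓝 a))
    (hle : ∀ q, b q ≤ Real.log ((boxColoringsWith Γ (m q) (c q)).card : ℝ) / (vol (m q) : ℝ)) :
    (a : EReal) ≤ densityEntropy Γ p := by
  refine le_trans ?_ (le_iSup_of_le m (le_iSup_of_le c (le_iSup_of_le h le_rfl)))
  rw [← ((EReal.tendsto_coe.2 hb).limsup_eq)]
  exact limsup_le_limsup (Eventually.of_forall fun q => EReal.coe_le_coe_iff.2 (hle q))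

theorem densityEntropy_nonneg (hp : p ∈ densityPoints Γ) : 0 ≤ densityEntropy Γ p := by
  obtain ⟨-, m, c, h⟩ := hp
  refine h.le_densityEntropy (b := fun _ => 0) tendsto_const_nhds fun q => ?_
  exact div_nonneg (Real.log_natCast_nonneg _) (Nat.cast_nonneg _)

/-- A value below `h_Γ(p)` is exceeded by the entropy of a large box of almost the density `p`. -/
theorem exists_box_of_lt_densityEntropy {a : ℝ} (ha : (a : EReal) < densityEntropy Γ p) (N : ℕ)
    {ε : ℝ} (hε : 0 < ε) : ∃ (m : Fin d → ℕ) (c : Fin n → ℕ), (∀ k, N ≤ m k) ∧ (∀ k, 1 ≤ m k) ∧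
      (boxColoringsWith Γ m c).Nonempty ∧ dist (density m c) p < ε ∧
      a < Real.log ((boxColoringsWith Γ m c).card : ℝ) / (vol m : ℝ) := by
  simp only [densityEntropy, lt_iSup_iff] at ha
  obtain ⟨m, c, h, ha⟩ := ha
  obtain ⟨q, hq, hN, hd⟩ := ((frequently_lt_of_lt_limsup (by isBoundedDefault) ha).and_eventually
    ((h.tendsto_box_atTop.eventually_ge_atTop fun _ => N).and
      (Metric.tendsto_nhds.1 (tendsto_density_iff.2 h.tendsto_density) ε hε))).exists
  exact ⟨m q, c q, hN, h.pos q, h.nonempty q, hd, EReal.coe_lt_coe_iff.1 hq⟩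

/-- The set of density points is closed and `h_Γ` is upper semicontinuous on it: the hypograph of
`h_Γ` is closed. A diagonal sequence of boxes realizes the limit. -/
theorem mem_densityPoints_and_le_of_tendsto {p : ℕ → EuclideanSpace ℝ (Fin n)}
    {p₀ : EuclideanSpace ℝ (Fin n)} {a : ℕ → ℝ} {a₀ : ℝ} (hp : Tendsto p atTop (𝓝 p₀))
    (ha : Tendsto a atTop (𝓝 a₀)) (h : ∀ i, (a i : EReal) < densityEntropy Γ (p i)) :
    p₀ ∈ densityPoints Γ ∧ (a₀ : EReal) ≤ densityEntropy Γ p₀ := by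
  choose m c hN hpos hne hd hlt using fun i : ℕ =>
    exists_box_of_lt_densityEntropy (h i) i (ε := 1 / ((i : ℝ) + 1)) (by positivity)
  have hdens : IsDensitySeq Γ p₀ m c := by
    refine ⟨hpos, fun k => tendsto_atTop_mono (fun i => hN i k) tendsto_id,
      fun i => sum_eq_vol_of_nonempty (hne i), hne, tendsto_density_iff.1 ?_⟩
    refine tendsto_of_tendsto_of_dist hp ?_
    refine squeeze_zero (fun _ => dist_nonneg) (fun i => ?_)
      (tendsto_one_div_add_atTop_nhds_zero_nat (𝕜 := ℝ))
    rw [dist_comm]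
    exact (hd i).le
  exact ⟨hdens.mem_densityPoints, hdens.le_densityEntropy ha fun i => (hlt i).le⟩

theorem isClosed_densityPoints : IsClosed (densityPoints Γ) := by
  refine isClosed_of_closure_subset fun p hp => ?_
  obtain ⟨x, hx, hlim⟩ := mem_closure_iff_seq_limit.1 hp
  refine (mem_densityPoints_and_le_of_tendsto hlim (tendsto_const_nhds (x := (-1 : ℝ)))
    fun i => lt_of_lt_of_le ?_ (densityEntropy_nonneg (hx i))).1
  exact_mod_cast (by norm_num : (-1 : ℝ) < 0)

theorem isCompact_densityPoints : IsCompact (densityPoints Γ) :=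
  (isCompact_probSimplex n).of_isClosed_subset isClosed_densityPoints fun _ hp => hp.1

/-! ### The variational principle -/

theorem card_mul_exp_le_partitionFunction (m : Fin d → ℕ) (c : Fin n → ℕ)
    (u : EuclideanSpace ℝ (Fin n)) :
    ((boxColoringsWith Γ m c).card : ℝ) * Real.exp (∑ i, (c i : ℝ) * u i) ≤
      partitionFunction Γ m u := by
  rw [← nsmul_eq_mul, ← Finset.sum_const]
  calc _ = ∑ φ ∈ boxColoringsWith Γ m c, Real.exp (∑ i, (colorCount φ i : ℝ) * u i) :=
        Finset.sum_congr rfl fun φ hφ => by rw [(Finset.mem_filter.1 hφ).2]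
    _ ≤ _ := Finset.sum_le_sum_of_subset_of_nonneg (Finset.filter_subset _ _)
        fun _ _ _ => (Real.exp_pos _).le

/-- Some color frequency vector carries the partition function up to the polynomial factor
`(vol m + 1) ^ n`, which bounds the number of such vectors. -/
theorem exists_partitionFunction_le (hΓ : (latticeColorings Γ).Nonempty) (m : Fin d → ℕ)
    (u : EuclideanSpace ℝ (Fin n)) : ∃ c : Fin n → ℕ, (boxColoringsWith Γ m c).Nonempty ∧
      partitionFunction Γ m u ≤ ((vol m : ℝ) + 1) ^ n *
        (((boxColoringsWith Γ m c).card : ℝ) * Real.exp (∑ i, (c i : ℝ) * u i)) := by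
  set T : Finset (Fin n → ℕ) := Fintype.piFinset fun _ => Finset.range (vol m + 1) with hT
  have hmaps : ∀ φ ∈ boxColorings Γ m, colorCount φ ∈ T := fun φ _ => by
    refine Fintype.mem_piFinset.2 fun i => Finset.mem_range_succ_iff.2 ?_
    rw [← sum_colorCount φ]
    exact Finset.single_le_sum (f := colorCount φ) (fun _ _ => Nat.zero_le _) (Finset.mem_univ i)
  have hsum : partitionFunction Γ m u = ∑ c ∈ T,
      ((boxColoringsWith Γ m c).card : ℝ) * Real.exp (∑ i, (c i : ℝ) * u i) := by
    rw [partitionFunction, ← Finset.sum_fiberwise_of_maps_to hmaps]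
    refine Finset.sum_congr rfl fun c _ => ?_
    rw [← nsmul_eq_mul, ← Finset.sum_const]
    refine Finset.sum_congr ?_ fun φ hφ => by rw [(Finset.mem_filter.1 hφ).2]
    ext φ
    simp [boxColoringsWith]
  obtain ⟨c, -, hc⟩ := T.exists_max_image
    (fun c => ((boxColoringsWith Γ m c).card : ℝ) * Real.exp (∑ i, (c i : ℝ) * u i))
    ⟨0, Fintype.mem_piFinset.2 fun i => by simp⟩
  have hle : partitionFunction Γ m u ≤ ((vol m : ℝ) + 1) ^ n *
      (((boxColoringsWith Γ m c).card : ℝ) * Real.exp (∑ i, (c i : ℝ) * u i)) := by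
    rw [hsum]
    refine (Finset.sum_le_card_nsmul _ _ _ hc).trans_eq ?_
    rw [nsmul_eq_mul, hT, Fintype.card_piFinset]
    simp
  refine ⟨c, ?_, hle⟩
  rw [Finset.nonempty_iff_ne_empty]
  intro h0
  have := (partitionFunction_pos hΓ m u).trans_le hle
  simp [h0] at this

theorem inner_density (m : Fin d → ℕ) (c : Fin n → ℕ) (u : EuclideanSpace ℝ (Fin n)) :
    inner ℝ (density m c) u = (∑ i, (c i : ℝ) * u i) / (vol m : ℝ) := by
  rw [inner_eq_sum, Finset.sum_div]
  exact Finset.sum_congr rfl fun i _ => div_mul_eq_mul_div _ _ _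

theorem densityEntropy_le (hΓ : (latticeColorings Γ).Nonempty) (p u : EuclideanSpace ℝ (Fin n)) :
    densityEntropy Γ p ≤ ((pressure Γ u - inner ℝ p u : ℝ) : EReal) := by
  refine iSup_le fun m => iSup_le fun c => iSup_le fun h => ?_
  have hlim := ((tendsto_pressure hΓ u).comp h.tendsto_box_atTop).sub
    ((tendsto_density_iff.2 h.tendsto_density).inner (tendsto_const_nhds (x := u)))
  rw [← (EReal.tendsto_coe.2 hlim).limsup_eq]
  refine limsup_le_limsup (Eventually.of_forall fun q => EReal.coe_le_coe_iff.2 ?_)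
  have hcard : (0 : ℝ) < (boxColoringsWith Γ (m q) (c q)).card := by
    exact_mod_cast (h.nonempty q).card_pos
  have hle := Real.log_le_log (by positivity)
    (card_mul_exp_le_partitionFunction (Γ := Γ) (m q) (c q) u)
  rw [Real.log_mul hcard.ne' (Real.exp_pos _).ne', Real.log_exp] at hle
  rw [Function.comp_apply, inner_density, ← sub_div]
  gcongr
  linarith

theorem exists_le_densityEntropy (hd : 1 ≤ d) (hΓ : (latticeColorings Γ).Nonempty)
    (u : EuclideanSpace ℝ (Fin n)) :
    ∃ p ∈ densityPoints Γ, ((pressure Γ u - inner ℝ p u : ℝ) : EReal) ≤ densityEntropy Γ p := by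
  let m : ℕ → Fin d → ℕ := fun q _ => q + 1
  have hm : ∀ q k, 1 ≤ m q k := fun q _ => Nat.le_add_left 1 q
  choose c hne hle using fun q => exists_partitionFunction_le hΓ (m q) u
  obtain ⟨p, -, ψ, hψ, hp⟩ := (isCompact_probSimplex n).tendsto_subseq
    (x := fun q => density (m q) (c q))
    fun q => density_mem_probSimplex (hm q) (sum_eq_vol_of_nonempty (hne q))
  have hdens : IsDensitySeq Γ p (m ∘ ψ) (c ∘ ψ) :=
    ⟨fun q => hm _, fun k => (tendsto_add_atTop_nat 1).comp hψ.tendsto_atTop,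
      fun q => sum_eq_vol_of_nonempty (hne _), fun q => hne _, tendsto_density_iff.1 hp⟩
  refine ⟨p, hdens.mem_densityPoints, ?_⟩
  have hvol : Tendsto (fun q => (vol ((m ∘ ψ) q) : ℝ)) atTop atTop := by
    refine tendsto_natCast_atTop_atTop.comp
      (tendsto_atTop_mono (fun q => ?_) hψ.tendsto_atTop)
    simp only [vol, m, Function.comp_apply, Finset.prod_const, Finset.card_univ, Fintype.card_fin]
    exact (Nat.le_succ _).trans (Nat.le_self_pow (by omega) _)
  have hlog : Tendsto (fun q => n * (Real.log ((vol ((m ∘ ψ) q) : ℝ) + 1) /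
      (vol ((m ∘ ψ) q) : ℝ))) atTop (𝓝 (n * 0)) := by
    refine Tendsto.const_mul _ ?_
    have := (Real.tendsto_pow_log_div_mul_add_atTop 1 (-1) 1 one_ne_zero).comp
      (tendsto_atTop_add_const_right _ (1 : ℝ) hvol)
    simpa [Function.comp_def] using this
  have hlim := (((tendsto_pressure hΓ u).comp hdens.tendsto_box_atTop).sub
    (hp.inner (tendsto_const_nhds (x := u)))).sub hlog
  rw [mul_zero, sub_zero] at hlim
  refine hdens.le_densityEntropy hlim fun q => ?_
  have hV : (0 : ℝ) < vol (m (ψ q)) := by exact_mod_cast vol_pos (hm _)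
  have hcard : (0 : ℝ) < (boxColoringsWith Γ (m (ψ q)) (c (ψ q))).card := by
    exact_mod_cast (hne _).card_pos
  have h1 := Real.log_le_log (partitionFunction_pos hΓ _ u) (hle (ψ q))
  rw [Real.log_mul (by positivity) (by positivity), Real.log_mul hcard.ne' (Real.exp_pos _).ne',
    Real.log_exp, Real.log_pow] at h1
  simp only [Function.comp_apply, inner_density]
  rw [← mul_div_assoc, ← sub_div, ← sub_div]
  gcongr
  linarith

/-- The density entropy is real at a maximizer, so the extended-real variational equation
amounts to one for real numbers. -/
theorem eq_densityFunctional_iff {u p : EuclideanSpace ℝ (Fin n)} :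
    ((pressure Γ u : ℝ) : EReal) = densityFunctional Γ u p ↔
      densityEntropy Γ p = ((pressure Γ u - inner ℝ p u : ℝ) : EReal) := by
  rw [densityFunctional]
  generalize densityEntropy Γ p = h
  induction h with
  | bot => exact iff_of_false (by simp) (EReal.bot_ne_coe _)
  | top => exact iff_of_false (by simp) (EReal.top_ne_coe _)
  | coe x =>
    norm_cast
    rw [eq_sub_iff_add_eq', eq_comm]

theorem densityFunctional_le (hΓ : (latticeColorings Γ).Nonempty)
    (u p : EuclideanSpace ℝ (Fin n)) :
    densityFunctional Γ u p ≤ ((pressure Γ u : ℝ) : EReal) := by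
  refine (add_le_add_right (densityEntropy_le hΓ p u) _).trans_eq ?_
  rw [← EReal.coe_add, add_sub_cancel]

theorem isGreatest_pressure (hd : 1 ≤ d) (hΓ : (latticeColorings Γ).Nonempty)
    (u : EuclideanSpace ℝ (Fin n)) :
    IsGreatest (densityFunctional Γ u '' densityPoints Γ) ((pressure Γ u : ℝ) : EReal) := by
  obtain ⟨p, hp, hle⟩ := exists_le_densityEntropy hd hΓ u
  refine ⟨⟨p, hp, (eq_densityFunctional_iff.2 ((densityEntropy_le hΓ p u).antisymm hle)).symm⟩, ?_⟩
  rintro _ ⟨p, -, rfl⟩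
  exact densityFunctional_le hΓ u p

theorem maximizers_eq (hd : 1 ≤ d) (hΓ : (latticeColorings Γ).Nonempty)
    (u : EuclideanSpace ℝ (Fin n)) : maximizers Γ u =
      {p | p ∈ densityPoints Γ ∧ ((pressure Γ u : ℝ) : EReal) = densityFunctional Γ u p} := by
  obtain ⟨p₀, hp₀, h₀⟩ := (isGreatest_pressure hd hΓ u).1
  ext p
  refine and_congr_right fun hp => ⟨fun hmax => ?_, fun h q hq => ?_⟩
  · exact (h₀.ge.trans (hmax hp₀)).antisymm (densityFunctional_le hΓ u p)
  · exact (densityFunctional_le hΓ u q).trans_eq h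

theorem mem_maximizers_iff (hd : 1 ≤ d) (hΓ : (latticeColorings Γ).Nonempty)
    {u p : EuclideanSpace ℝ (Fin n)} : p ∈ maximizers Γ u ↔ p ∈ densityPoints Γ ∧
      ((pressure Γ u - inner ℝ p u : ℝ) : EReal) ≤ densityEntropy Γ p := by
  rw [maximizers_eq hd hΓ, Set.mem_ofPred_eq, eq_densityFunctional_iff]
  exact and_congr_right fun _ => ⟨fun h => h.ge, fun h => (densityEntropy_le hΓ p u).antisymm h⟩

theorem maximizers_nonempty (hd : 1 ≤ d) (hΓ : (latticeColorings Γ).Nonempty)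
    (u : EuclideanSpace ℝ (Fin n)) : (maximizers Γ u).Nonempty := by
  obtain ⟨p, hp⟩ := exists_le_densityEntropy hd hΓ u
  exact ⟨p, (mem_maximizers_iff hd hΓ).2 hp⟩

/-! ### Conjugate and subgradients of the pressure -/

theorem densityEntropy_le_neg_conjugate (hΓ : (latticeColorings Γ).Nonempty)
    (p : EuclideanSpace ℝ (Fin n)) : densityEntropy Γ p ≤ -conjugate (pressure Γ) p := by
  rw [EReal.le_neg]
  refine iSup_le fun u => EReal.le_neg.2 ((densityEntropy_le hΓ p u).trans_eq ?_)
  rw [← EReal.coe_neg, neg_sub, real_inner_comm]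

theorem densityEntropy_eq_neg_conjugate (hd : 1 ≤ d) (hΓ : (latticeColorings Γ).Nonempty)
    {u p : EuclideanSpace ℝ (Fin n)} (hp : p ∈ maximizers Γ u) :
    densityEntropy Γ p = -conjugate (pressure Γ) p := by
  refine (densityEntropy_le_neg_conjugate hΓ p).antisymm
    (le_trans ?_ ((mem_maximizers_iff hd hΓ).1 hp).2)
  rw [EReal.neg_le, ← EReal.coe_neg, neg_sub, real_inner_comm]
  exact le_iSup (fun u => ((inner ℝ u p - pressure Γ u : ℝ) : EReal)) u

theorem maximizers_subset_subdifferential (hd : 1 ≤ d) (hΓ : (latticeColorings Γ).Nonempty)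
    (u : EuclideanSpace ℝ (Fin n)) : maximizers Γ u ⊆ subdifferential (pressure Γ) u := by
  intro p hp z
  have h := EReal.coe_le_coe_iff.1
    (((mem_maximizers_iff hd hΓ).1 hp).2.trans (densityEntropy_le hΓ p z))
  rw [inner_sub_right]
  linarith

/-- The maximizers supply a bounded subgradient of the pressure at every point. -/
theorem exists_mem_subdifferential_norm_le (hd : 1 ≤ d) (hΓ : (latticeColorings Γ).Nonempty)
    (u : EuclideanSpace ℝ (Fin n)) : ∃ y ∈ subdifferential (pressure Γ) u, ‖y‖ ≤ 1 := by
  obtain ⟨p, hp⟩ := maximizers_nonempty hd hΓ u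
  exact ⟨p, maximizers_subset_subdifferential hd hΓ u hp, norm_le_one_of_mem_probSimplex hp.1.1⟩

theorem maximizers_eq_singleton (hd : 1 ≤ d) (hΓ : (latticeColorings Γ).Nonempty)
    {u : EuclideanSpace ℝ (Fin n)} (hu : u ∈ derSet (pressure Γ)) :
    maximizers Γ u = {gradient (pressure Γ) u} :=
  Set.eq_singleton_iff_nonempty_unique_mem.2 ⟨maximizers_nonempty hd hΓ u, fun _ hp =>
    eq_gradient_of_mem_subdifferential hu (maximizers_subset_subdifferential hd hΓ u hp)⟩

theorem gradientLimits_subset_maximizers (hd : 1 ≤ d) (hΓ : (latticeColorings Γ).Nonempty)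
    (u : EuclideanSpace ℝ (Fin n)) : gradientLimits (pressure Γ) u ⊆ maximizers Γ u := by
  rintro p ⟨s, hs, hsu, hsp⟩
  have hcont := (lipschitzWith_of_subdifferential
    (exists_mem_subdifferential_norm_le hd hΓ)).continuous
  have hmem : ∀ i, gradient (pressure Γ) (s i) ∈ maximizers Γ (s i) := fun i =>
    (maximizers_eq_singleton hd hΓ (hs i)).symm ▸ rfl
  have hlim := (((hcont.tendsto u).comp hsu).sub (hsp.inner hsu)).sub
    (tendsto_one_div_add_atTop_nhds_zero_nat (𝕜 := ℝ))
  rw [sub_zero] at hlim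
  refine (mem_maximizers_iff hd hΓ).2 (mem_densityPoints_and_le_of_tendsto hsp hlim fun i => ?_)
  refine lt_of_lt_of_le (EReal.coe_lt_coe_iff.2 ?_) ((mem_maximizers_iff hd hΓ).1 (hmem i)).2
  exact sub_lt_self _ (by positivity)

theorem convexHull_maximizers_subset (hd : 1 ≤ d) (hΓ : (latticeColorings Γ).Nonempty)
    (u : EuclideanSpace ℝ (Fin n)) :
    convexHull ℝ (maximizers Γ u) ⊆ subdifferential (pressure Γ) u :=
  convexHull_min (maximizers_subset_subdifferential hd hΓ u) (convex_subdifferential u)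

theorem convexHull_gradientLimits (hd : 1 ≤ d) (hΓ : (latticeColorings Γ).Nonempty)
    (u : EuclideanSpace ℝ (Fin n)) :
    convexHull ℝ (gradientLimits (pressure Γ) u) = subdifferential (pressure Γ) u :=
  ((convexHull_mono (gradientLimits_subset_maximizers hd hΓ u)).trans
    (convexHull_maximizers_subset hd hΓ u)).antisymm
    (subdifferential_subset_convexHull_gradientLimits
      (exists_mem_subdifferential_norm_le hd hΓ) u)

theorem convexHull_maximizers (hd : 1 ≤ d) (hΓ : (latticeColorings Γ).Nonempty)
    (u : EuclideanSpace ℝ (Fin n)) :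
    convexHull ℝ (maximizers Γ u) = subdifferential (pressure Γ) u :=
  (convexHull_maximizers_subset hd hΓ u).antisymm <| (convexHull_gradientLimits hd hΓ u).symm.trans_le
    (convexHull_mono (gradientLimits_subset_maximizers hd hΓ u))

/-- If `p` lies outside the compact set `conv Π_Γ`, then along a separating direction the pressure
grows more slowly than the linear functional of `p`, so the conjugate is infinite at `p`. -/
theorem convexHull_densityPoints (hd : 1 ≤ d) (hΓ : (latticeColorings Γ).Nonempty) :
    convexHull ℝ (densityPoints Γ) = effDom (conjugate (pressure Γ)) := by
  apply Set.Subset.antisymm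
  · have hsub : convexHull ℝ (densityPoints Γ) ⊆ {p | ∀ u, inner ℝ p u ≤ pressure Γ u} := by
      refine convexHull_min (fun p hp u => ?_) fun x hx y hy a b ha hb hab u => ?_
      · have := (densityEntropy_nonneg hp).trans (densityEntropy_le hΓ p u)
        rw [EReal.coe_nonneg] at this
        linarith
      · have h1 := mul_le_mul_of_nonneg_left (hx u) ha
        have h2 := mul_le_mul_of_nonneg_left (hy u) hb
        rw [inner_add_left, real_inner_smul_left, real_inner_smul_left]
        obtain rfl : b = 1 - a := by linarith
        linarith
    intro p hp
    refine lt_of_le_of_lt (iSup_le fun u => ?_) EReal.zero_lt_top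
    have := hsub hp u
    rw [real_inner_comm] at this
    exact_mod_cast sub_nonpos.2 this
  · intro p hp
    by_contra hnp
    obtain ⟨φ, a, hφ, hpa⟩ := geometric_hahn_banach_closed_point (convex_convexHull ℝ _)
      (isCompact_convexHull_of_isCompact (isCompact_densityPoints (Γ := Γ))).isClosed hnp
    set v := (InnerProductSpace.toDual ℝ (EuclideanSpace ℝ (Fin n))).symm φ with hv
    have hφv : ∀ z, φ z = inner ℝ z v := fun z => by
      rw [real_inner_comm, hv, InnerProductSpace.toDual_symm_apply]
    have hgrow : ∀ t : ℝ, 0 ≤ t → pressure Γ (t • v) ≤ t * a + pressure Γ 0 := by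
      intro t ht
      obtain ⟨q, hq, hle⟩ := exists_le_densityEntropy hd hΓ (t • v)
      have h1 := EReal.coe_le_coe_iff.1 (hle.trans (densityEntropy_le hΓ q 0))
      have h2 := mul_le_mul_of_nonneg_left (hφ q (subset_convexHull ℝ _ hq)).le ht
      rw [hφv] at h2
      rw [real_inner_smul_right, inner_zero_right] at h1
      linarith
    refine hp.ne (EReal.eq_top_iff_forall_lt _ |>.2 fun y => ?_)
    rw [hφv] at hpa
    -- large enough for `t * (⟪p, v⟫ - a) - P(0)` to exceed `y`
    set t := (|y + pressure Γ 0| + 1) / (inner ℝ p v - a) with ht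
    have hpos : 0 < inner ℝ p v - a := sub_pos.2 hpa
    have hmul : t * (inner ℝ p v - a) = |y + pressure Γ 0| + 1 := div_mul_cancel₀ _ hpos.ne'
    refine lt_of_lt_of_le (EReal.coe_lt_coe_iff.2 ?_)
      (le_iSup (fun u => ((inner ℝ u p - pressure Γ u : ℝ) : EReal)) (t • v))
    have h1 := hgrow t (by positivity)
    rw [real_inner_smul_left, real_inner_comm]
    linarith [le_abs_self (y + pressure Γ 0)]

theorem notMem_derSet_iff (hd : 1 ≤ d) (hΓ : (latticeColorings Γ).Nonempty)
    (u : EuclideanSpace ℝ (Fin n)) :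
    u ∉ derSet (pressure Γ) ↔ (maximizers Γ u).Nontrivial := by
  rw [← not_iff_not, not_not, Set.not_nontrivial_iff]
  constructor
  · intro hu
    rw [maximizers_eq_singleton hd hΓ hu]
    exact Set.subsingleton_singleton
  · intro hsub
    obtain ⟨p, hp⟩ := maximizers_nonempty hd hΓ u
    refine differentiableAt_of_subdifferential_subset_singleton (p := p)
      (exists_mem_subdifferential_norm_le hd hΓ) ?_
    rw [← convexHull_maximizers hd hΓ, hsub.eq_singleton_of_mem hp, convexHull_singleton]

end Density

end NNSOFT

theorem theorem4p4 {d n : ℕ} (hd : 1 ≤ d) (Γ : Fin d → Digraph (Fin n))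
    (hΓ : (latticeColorings Γ).Nonempty) :
    -- the limit that defines the pressure exists and is finite
    (∀ u, Tendsto (fun m : Fin d → ℕ => Real.log (partitionFunction Γ m u) / (vol m : ℝ))
      atTop (𝓝 (pressure Γ u))) ∧
    -- the density entropy is bounded by the negative conjugate
    (∀ p ∈ densityPoints Γ, 0 ≤ densityEntropy Γ p ∧
      densityEntropy Γ p ≤ -conjugate (pressure Γ) p) ∧
    -- variational principle, with attained maximum, and the two descriptions of the maximizers
    (∀ u, IsGreatest (densityFunctional Γ u '' densityPoints Γ) ((pressure Γ u : ℝ) : EReal)) ∧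
    (∀ u, maximizers Γ u =
      {p | p ∈ densityPoints Γ ∧ ((pressure Γ u : ℝ) : EReal) = densityFunctional Γ u p}) ∧
    -- equality of the density entropy and the negative conjugate at every maximizer
    (∀ u, ∀ p ∈ maximizers Γ u, densityEntropy Γ p = -conjugate (pressure Γ) p) ∧
    -- maximizers are subgradients
    (∀ u, maximizers Γ u ⊆ subdifferential (pressure Γ) u) ∧
    (∀ u ∈ derSet (pressure Γ), maximizers Γ u = {gradient (pressure Γ) u}) ∧
    (⋃ u ∈ derSet (pressure Γ), subdifferential (pressure Γ) u) ⊆ densityPoints Γ ∧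
    -- limits of nearby gradients are maximizers
    (∀ u, gradientLimits (pressure Γ) u ⊆ maximizers Γ u) ∧
    -- convex hulls
    (∀ u, convexHull ℝ (maximizers Γ u) = subdifferential (pressure Γ) u ∧
      convexHull ℝ (gradientLimits (pressure Γ) u) = subdifferential (pressure Γ) u) ∧
    (⋃ u, subdifferential (pressure Γ) u) ⊆ convexHull ℝ (densityPoints Γ) ∧
    convexHull ℝ (densityPoints Γ) ⊆ probSimplex n ∧
    -- effective domain of the conjugate
    convexHull ℝ (densityPoints Γ) = effDom (conjugate (pressure Γ)) ∧
    -- non-differentiability is non-uniqueness of the color densities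
    (∀ u, u ∉ derSet (pressure Γ) ↔ (maximizers Γ u).Nontrivial) := by
  refine ⟨tendsto_pressure hΓ,
    fun p hp => ⟨densityEntropy_nonneg hp, densityEntropy_le_neg_conjugate hΓ p⟩,
    isGreatest_pressure hd hΓ, maximizers_eq hd hΓ,
    fun u p hp => densityEntropy_eq_neg_conjugate hd hΓ hp,
    maximizers_subset_subdifferential hd hΓ, fun u hu => maximizers_eq_singleton hd hΓ hu,
    Set.iUnion₂_subset fun u hu y hy => ?_, gradientLimits_subset_maximizers hd hΓ,
    fun u => ⟨convexHull_maximizers hd hΓ u, convexHull_gradientLimits hd hΓ u⟩,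
    Set.iUnion_subset fun u => ?_, convexHull_min (fun p hp => hp.1) (convex_probSimplex n),
    convexHull_densityPoints hd hΓ, notMem_derSet_iff hd hΓ⟩
  · obtain rfl := eq_gradient_of_mem_subdifferential hu hy
    exact ((maximizers_eq_singleton hd hΓ hu).ge rfl).1
  · rw [← convexHull_maximizers hd hΓ u]
    exact convexHull_mono fun p hp => hp.1
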